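/- Let $G$ be a finite group and let $p$ be a prime dividing $|G|$. Let $\mathcal S_p(G)$ be the set of nontrivial $p$-subgroups of $G$, partially ordered by inclusion, and let $|\mathcal S_p(G)|$ be the geometric realization of its order complex, i.e. of the simplicial complex whose simplices are the nonempty finite chains $P_0<\cdots<P_n$ in $\mathcal S_p(G)$. The group $G$ acts on $\mathcal S_p(G)$ by conjugation, $g\cdot P=gPg^{-1}$, and hence on $|\mathcal S_p(G)|$ by homeomorphisms that are affine on each simplex. Then the orbit space $|\mathcal S_p(G)|/G$, with the quotient topology, is contractible. -/

import Mathlib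

open scoped Pointwise

/-- The order complex of a partially ordered set: the abstract simplicial complex whose simplices
are the nonempty finite chains. -/
def orderComplex (S : Type*) [PartialOrder S] : AbstractSimplicialComplex S where
  faces := {s | s.Nonempty ∧ IsChain (· ≤ ·) (s : Set S)}
  isRelLowerSet_faces := fun _ hs =>
    ⟨hs.1, fun _ hts ht => ⟨ht, hs.2.mono (Finset.coe_subset.mpr hts)⟩⟩
  singleton_mem := fun v => ⟨Finset.singleton_nonempty v, by simp⟩

/-- The geometric realization of an abstract simplicial complex `K` on a finite vertex set: the
points of the standard simplex on the vertices (barycentric coordinates) which are supported on a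
simplex of `K`, with the topology of a subspace of the finite-dimensional space `ι → ℝ`. -/
def geometricRealization {ι : Type*} [Fintype ι] (K : AbstractSimplicialComplex ι) : Type _ :=
  {x : ι → ℝ // x ∈ stdSimplex ℝ ι ∧ ∃ s ∈ K.faces, Function.support x ⊆ (s : Set ι)}

instance geometricRealization.instTopologicalSpace {ι : Type*} [Fintype ι]
    (K : AbstractSimplicialComplex ι) : TopologicalSpace (geometricRealization K) :=
  inferInstanceAs (TopologicalSpace
    {x : ι → ℝ // x ∈ stdSimplex ℝ ι ∧ ∃ s ∈ K.faces, Function.support x ⊆ (s : Set ι)})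

/-- The poset `S_p(G)` of nontrivial `p`-subgroups of `G`, ordered by inclusion. -/
abbrev PSubgroups (p : ℕ) (G : Type*) [Group G] : Type _ :=
  {P : Subgroup G // IsPGroup p P ∧ P ≠ ⊥}

noncomputable instance PSubgroups.instFintype (p : ℕ) (G : Type*) [Group G] [Finite G] :
    Fintype (PSubgroups p G) :=
  Fintype.ofFinite _

/-- `G` acts on `S_p(G)` by conjugation, `g • P = g P g⁻¹`. -/
instance PSubgroups.instMulAction (p : ℕ) (G : Type*) [Group G] :
    MulAction G (PSubgroups p G) where
  smul g P := ⟨MulAut.conj g • P.1, P.2.1.of_equiv (Subgroup.equivSMul (MulAut.conj g) P.1),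
    fun h => P.2.2 (by
      have h' := congrArg (fun Q : Subgroup G => (MulAut.conj g)⁻¹ • Q) h
      simpa using h')⟩
  one_smul P := Subtype.ext (by
    change MulAut.conj (1 : G) • P.1 = P.1
    rw [map_one, one_smul])
  mul_smul g h P := Subtype.ext (by
    change MulAut.conj (g * h) • P.1 = MulAut.conj g • MulAut.conj h • P.1
    rw [map_mul, mul_smul])

/-- Conjugation preserves inclusions. -/
theorem PSubgroups.smul_le_smul {p : ℕ} {G : Type*} [Group G] (g : G) {P Q : PSubgroups p G}
    (h : P ≤ Q) : g • P ≤ g • Q :=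
  Subgroup.pointwise_smul_le_pointwise_smul_iff.mpr h

/-- The `p`-subgroup complex `|S_p(G)|`: the geometric realization of the order complex of the poset
of nontrivial `p`-subgroups of the finite group `G`. -/
abbrev PSubgroupComplex (p : ℕ) (G : Type*) [Group G] [Finite G] : Type _ :=
  geometricRealization (orderComplex (PSubgroups p G))

/-- The action of `G` on `|S_p(G)|` induced by conjugation: the element `g` is affine on each
simplex and carries the vertex `P` to the vertex `g P g⁻¹`. In barycentric coordinates this reads
`(g • x) P = x (g⁻¹ • P)`. -/
instance PSubgroupComplex.instMulAction (p : ℕ) (G : Type*) [Group G] [Finite G] :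
    MulAction G (PSubgroupComplex p G) where
  smul g x := ⟨fun P => x.1 (g⁻¹ • P),
    ⟨fun P => x.2.1.1 _,
      (Equiv.sum_comp (MulAction.toPerm g⁻¹) x.1).trans x.2.1.2⟩, by
    classical
    obtain ⟨s, hs, hxs⟩ := x.2.2
    refine ⟨s.image (g • ·), ⟨hs.1.image _, ?_⟩, fun P hP => ?_⟩
    · rw [Finset.coe_image]
      rintro _ ⟨P, hP, rfl⟩ _ ⟨Q, hQ, rfl⟩ -
      exact (hs.2.total hP hQ).imp (PSubgroups.smul_le_smul g) (PSubgroups.smul_le_smul g)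
    · rw [Finset.coe_image]
      exact ⟨g⁻¹ • P, hxs hP, smul_inv_smul g P⟩⟩
  one_smul x := Subtype.ext (funext fun P => by
    change x.1 ((1 : G)⁻¹ • P) = x.1 P
    rw [inv_one, one_smul])
  mul_smul g h x := Subtype.ext (funext fun P => by
    change x.1 ((g * h)⁻¹ • P) = x.1 (h⁻¹ • g⁻¹ • P)
    rw [mul_inv_rev, mul_smul])

/-! The orbit space is collapsed to a point along a matching of orbits of chains. In a chain `σ` let
`M` be the largest member that normalizes all members below it. Its `hull` is the group that
normalizes the members up to `M` and lies in the later ones; let `T` be a Sylow `p`-subgroup of the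
hull containing `M`. If `T ∉ σ`, then `σ` is matched with `insert T σ`.

The choice of `T` is not canonical, but the hull fixes every member of `σ`, so by Sylow's theorem
any two choices are conjugate under the stabilizer of `σ` (`IsApex.exists_smul_eq`). The matching is
thus well defined on orbits, though not on chains. Since normalizers grow in `p`-groups, the only
unmatched chains are single Sylow `p`-subgroups (`isApex_trichotomy`), and these form one orbit.

The function `level` excludes cycles in the matching: an invariant subcomplex with a matched pair
has one that is free up to conjugation (`ApexClosed.exists_free`). An element of `G` preserving a
chain fixes its vertices, so open simplices embed in the orbit space, and removing the two orbits is
an elementary collapse there (`contractibleSpace_of_collapse`). Induction on the subcomplex ends at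
a point. -/

/-! ### Gluing along a deformation retract -/

open scoped unitInterval in
/-- If a compact space `D` deformation retracts onto `Λ`, and `B` is obtained from the closed
subspace `A` by gluing `D` along `Λ`, then `B` is contractible as soon as `A` is. -/
theorem contractibleSpace_of_attach {Y D : Type*} [TopologicalSpace Y] [T2Space Y]
    [TopologicalSpace D] [CompactSpace D] {A B : Set Y} (hA : IsCompact A) {f : D → Y}
    (hf : Continuous f) (hB : B = A ∪ Set.range f) {Λ : Set D} (hΛ : ∀ x, f x ∈ A ↔ x ∈ Λ)
    (hinj : Set.InjOn f Λᶜ) (H : C(D × I, D)) (H0 : ∀ x, H (x, 0) = x)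
    (H1 : ∀ x, H (x, 1) ∈ Λ) (HΛ : ∀ x ∈ Λ, ∀ t, H (x, t) = x) [ContractibleSpace A] :
    ContractibleSpace B := by
  have : CompactSpace A := isCompact_iff_compactSpace.mp hA
  have hAB : A ⊆ B := hB ▸ Set.subset_union_left
  have hfB : ∀ x, f x ∈ B := fun x => hB ▸ Or.inr ⟨x, rfl⟩
  let i : C(A, B) := ⟨Set.inclusion hAB, continuous_inclusion hAB⟩
  let f' : C(D, B) := ⟨fun x => ⟨f x, hfB x⟩, by fun_prop⟩
  let q : C((A × I) ⊕ (D × I), B × I) :=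
    ⟨Sum.elim (fun z => (i z.1, z.2)) (fun z => (f' z.1, z.2)), by
      apply Continuous.sumElim <;> fun_prop⟩
  let g : C((A × I) ⊕ (D × I), B) :=
    ⟨Sum.elim (fun z => i z.1) (fun z => f' (H z)), by
      apply Continuous.sumElim <;> fun_prop⟩
  -- A continuous surjection from a compact space to a Hausdorff space is a quotient map, so the
  -- homotopy, constant on `A` and equal to `H` on `D`, descends to `B × I`.
  have hq : Topology.IsQuotientMap q := by
    refine Topology.IsQuotientMap.of_surjective_continuous ?_ q.continuous
    rintro ⟨⟨b, hb⟩, t⟩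
    rcases hB ▸ hb with h | ⟨x, rfl⟩
    · exact ⟨Sum.inl (⟨b, h⟩, t), rfl⟩
    · exact ⟨Sum.inr (x, t), rfl⟩
  have key : ∀ (a : A) (x : D) (t : I), (a : Y) = f x → i a = f' (H (x, t)) := by
    intro a x t h
    have hx : x ∈ Λ := (hΛ x).1 (h ▸ a.2)
    rw [HΛ x hx]
    exact Subtype.ext h
  have hg : Function.FactorsThrough g q := by
    rintro (⟨a, s⟩ | ⟨x, s⟩) (⟨b, t⟩ | ⟨y, t⟩) h
    · exact congrArg Prod.fst h
    · exact key a y t (congrArg (fun z : B × I => (z.1 : Y)) h)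
    · exact (key b x s (congrArg (fun z : B × I => (z.1 : Y)) h).symm).symm
    · have h1 : f x = f y := congrArg (fun z : B × I => (z.1 : Y)) h
      have h2 : s = t := congrArg Prod.snd h
      subst h2
      change f' (H (x, s)) = f' (H (y, s))
      by_cases hx : x ∈ Λ
      · have hy : y ∈ Λ := (hΛ y).1 (h1 ▸ (hΛ x).2 hx)
        rw [HΛ x hx, HΛ y hy]
        exact Subtype.ext h1
      · have hy : y ∉ Λ := fun hy => hx ((hΛ x).1 (h1 ▸ (hΛ y).2 hy))
        rw [hinj hx hy h1]
  let Φ : C(B × I, B) := hq.lift g hg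
  have hΦ : ∀ z, Φ (q z) = g z := fun z => congrArg (fun k : C(_, _) => k z) (hq.lift_comp g hg)
  have hΦA : ∀ (a : A) t, Φ (i a, t) = i a := fun a t => hΦ (Sum.inl (a, t))
  have hΦD : ∀ x t, Φ (f' x, t) = f' (H (x, t)) := fun x t => hΦ (Sum.inr (x, t))
  have hcases : ∀ b : B, (∃ a, b = i a) ∨ ∃ x, b = f' x := by
    rintro ⟨b, hb⟩
    rcases hB ▸ hb with h | ⟨x, rfl⟩
    · exact Or.inl ⟨⟨b, h⟩, rfl⟩
    · exact Or.inr ⟨x, rfl⟩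
  have h1A : ∀ b, (Φ (b, 1) : Y) ∈ A := by
    intro b
    rcases hcases b with ⟨a, rfl⟩ | ⟨x, rfl⟩
    · rw [hΦA]; exact a.2
    · rw [hΦD]; exact (hΛ _).2 (H1 x)
  have h0 : ∀ b, Φ (b, 0) = b := by
    intro b
    rcases hcases b with ⟨a, rfl⟩ | ⟨x, rfl⟩
    · rw [hΦA]
    · rw [hΦD, H0]
  let r : C(B, A) := ⟨fun b => ⟨Φ (b, 1), h1A b⟩, by fun_prop⟩
  have hid : (ContinuousMap.id B).Homotopic (i.comp r) :=
    ⟨{ toFun := fun z => Φ (z.2, z.1)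
       continuous_toFun := by fun_prop
       map_zero_left := h0
       map_one_left := fun b => rfl }⟩
  rw [contractible_iff_id_nullhomotopic]
  obtain ⟨y, hy⟩ := ((id_nullhomotopic A).comp_right i).comp_left r
  exact ⟨y, hid.trans hy⟩

section
open scoped Classical

/-! ### Conjugation and normalizers of `p`-subgroups -/

namespace PSubgroups

variable {p : ℕ} {G : Type*} [Group G]

theorem le_stabilizer_self (P : PSubgroups p G) : P.1 ≤ MulAction.stabilizer G P :=
  fun _ hg => Subtype.ext (Subgroup.conj_smul_eq_self_of_mem hg)

theorem coe_smul (g : G) (P : PSubgroups p G) : (g • P).1 = MulAut.conj g • P.1 := rfl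

theorem stabilizer_eq_normalizer (P : PSubgroups p G) :
    MulAction.stabilizer G P = Subgroup.normalizer (P.1 : Set G) := by
  ext g
  rw [MulAction.mem_stabilizer_iff, Subtype.ext_iff, coe_smul, SetLike.ext_iff,
    ← inv_mem_iff, Subgroup.mem_normalizer_iff]
  refine forall_congr' fun h => ?_
  rw [Subgroup.mem_pointwise_smul_iff_inv_smul_mem, ← map_inv, MulAut.smul_def, MulAut.conj_apply]
  exact Iff.comm

theorem smul_le_smul_iff (g : G) {P Q : PSubgroups p G} : g • P ≤ g • Q ↔ P ≤ Q :=
  Subgroup.pointwise_smul_le_pointwise_smul_iff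

/-- Conjugate subgroups have the same order, so comparable ones coincide. -/
theorem eq_of_smul_comparable [Finite G] {g : G} {P : PSubgroups p G}
    (h : g • P ≤ P ∨ P ≤ g • P) : g • P = P := by
  have hc : Nat.card (g • P).1 = Nat.card P.1 :=
    (Nat.card_congr (Subgroup.equivSMul (MulAut.conj g) P.1).toEquiv).symm
  rcases h with h | h
  · exact Subtype.ext (Subgroup.eq_of_le_of_card_ge h hc.ge)
  · exact Subtype.ext (Subgroup.eq_of_le_of_card_ge h hc.le).symm

/-- Normalizers grow in `p`-groups. -/
theorem exists_lt_le_stabilizer [Finite G] [Fact p.Prime] {M S : PSubgroups p G} (h : M < S) :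
    ∃ T : PSubgroups p G, M < T ∧ T ≤ S ∧ T.1 ≤ MulAction.stabilizer G M := by
  have hMS : M.1 ≤ S.1 := h.le
  have : Group.IsNilpotent S.1 := S.2.1.isNilpotent
  have hlt : M.1.subgroupOf S.1 < ⊤ := by
    refine lt_top_iff_ne_top.2 fun he => ?_
    exact h.not_ge (Subgroup.subgroupOf_eq_top.1 he)
  have h2 := Group.normalizerCondition_of_isNilpotent _ hlt
  rw [← Subgroup.subgroupOf_normalizer_eq hMS, ← stabilizer_eq_normalizer] at h2
  have hM : M.1 ≤ S.1 ⊓ MulAction.stabilizer G M := le_inf hMS M.le_stabilizer_self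
  -- The witness is the normalizer of `M` in `S`.
  refine ⟨⟨S.1 ⊓ MulAction.stabilizer G M, S.2.1.to_inf_left, ?_⟩, lt_of_le_not_ge hM ?_,
    fun _ h => h.1, fun _ h => h.2⟩
  · exact fun hb => M.2.2 (le_bot_iff.1 (hM.trans hb.le))
  · intro hle
    exact h2.not_ge fun x hx => hle ⟨x.2, hx⟩

/-! ### Hulls and apices -/

/-- The largest subgroup which normalizes the members of `σ` below `M` and is contained in the
remaining ones. -/
noncomputable def hull (σ : Finset (PSubgroups p G)) (M : PSubgroups p G) : Subgroup G :=
  ⨅ P ∈ σ, if P ≤ M then MulAction.stabilizer G P else P.1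

theorem le_hull_iff {σ : Finset (PSubgroups p G)} {M : PSubgroups p G} {T : Subgroup G} :
    T ≤ hull σ M ↔ ∀ P ∈ σ, (P ≤ M → T ≤ MulAction.stabilizer G P) ∧ (¬ P ≤ M → T ≤ P.1) := by
  simp only [hull, le_iInf_iff]
  refine forall₂_congr fun P _ => ?_
  split_ifs with h <;> simp [h]

/-- Each `P` normalizes itself, so both alternatives in the hull fix `P`. Hence conjugation by the
hull does not move the chain. -/
theorem hull_le_stabilizer {σ : Finset (PSubgroups p G)} {M P : PSubgroups p G} (hP : P ∈ σ) :
    hull σ M ≤ MulAction.stabilizer G P := by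
  by_cases h : P ≤ M
  · exact (le_hull_iff.1 le_rfl P hP).1 h
  · exact ((le_hull_iff.1 le_rfl P hP).2 h).trans P.le_stabilizer_self

theorem stabilizer_smul_le {T P : PSubgroups p G} (g : G)
    (h : T.1 ≤ MulAction.stabilizer G P) : (g • T).1 ≤ MulAction.stabilizer G (g • P) := by
  rw [MulAction.stabilizer_smul_eq_stabilizer_map_conj]
  exact Subgroup.map_mono h

theorem smul_le_hull_smul {σ : Finset (PSubgroups p G)} {M T : PSubgroups p G} (g : G)
    (h : T.1 ≤ hull σ M) : (g • T).1 ≤ hull (g • σ) (g • M) := by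
  rw [le_hull_iff] at h ⊢
  intro P hP
  obtain ⟨P, hPσ, rfl⟩ := Finset.mem_smul_finset.1 hP
  rw [smul_le_smul_iff]
  exact ⟨fun hM => stabilizer_smul_le g ((h P hPσ).1 hM),
    fun hM => smul_le_smul g (P := T) ((h P hPσ).2 hM)⟩

/-- `T` is an apex over the chain `σ`: if `M` is the largest member of `σ` which normalizes
everything below it in `σ`, then `T` is a new subgroup inserted right above `M`, and it is maximal
among the `p`-subgroups which normalize the members of `σ` up to `M` and lie below the others. -/
def IsApex (σ : Finset (PSubgroups p G)) (T : PSubgroups p G) : Prop :=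
  T ∉ σ ∧ ∃ M ∈ σ, M < T ∧ Maximal (fun S : PSubgroups p G => S.1 ≤ hull σ M) T

theorem IsApex.smul {σ : Finset (PSubgroups p G)} {T : PSubgroups p G} (h : IsApex σ T) (g : G) :
    IsApex (g • σ) (g • T) := by
  obtain ⟨hT, M, hM, hMT, hmax⟩ := h
  refine ⟨by rwa [Finset.smul_mem_smul_finset_iff], g • M, Finset.smul_mem_smul_finset hM,
    lt_of_le_not_ge ((smul_le_smul_iff g).2 hMT.le) fun h => hMT.not_ge ((smul_le_smul_iff g).1 h),
    smul_le_hull_smul g hmax.1, fun S hS hTS => ?_⟩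
  have h1 := smul_le_hull_smul g⁻¹ hS
  rw [inv_smul_smul, inv_smul_smul] at h1
  have h2 := hmax.2 h1 (by rw [← smul_le_smul_iff g, smul_inv_smul]; exact hTS)
  rwa [← smul_le_smul_iff g, smul_inv_smul] at h2

/-- The member `Q` of `σ` normalizes all members of `σ` below it. -/
def NormalIn (σ : Finset (PSubgroups p G)) (Q : PSubgroups p G) : Prop :=
  Q ∈ σ ∧ ∀ P ∈ σ, P ≤ Q → Q.1 ≤ MulAction.stabilizer G P

theorem NormalIn.mono {σ : Finset (PSubgroups p G)} {Q R : PSubgroups p G} (h : NormalIn σ Q)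
    (hR : R ∈ σ) (hRQ : R ≤ Q) : NormalIn σ R :=
  ⟨hR, fun P hP hPR => le_trans (show R.1 ≤ Q.1 from hRQ) (h.2 P hP (hPR.trans hRQ))⟩

/-! ### The matching of chains with their apices -/

section Chain

variable {σ : Finset (PSubgroups p G)}

theorem normalIn_base {M T : PSubgroups p G} (hM : M ∈ σ) (hMT : M < T) (hT : T.1 ≤ hull σ M) :
    NormalIn σ M :=
  ⟨hM, fun P hP hPM => le_trans (show M.1 ≤ T.1 from hMT.le) ((le_hull_iff.1 hT P hP).1 hPM)⟩

/-- This determines the base `M` of an apex from `σ` alone, as the largest member normalizing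
everything below it. -/
theorem le_base_of_normalIn (hσ : IsChain (· ≤ ·) (σ : Set (PSubgroups p G)))
    {M T Q : PSubgroups p G} (hTσ : T ∉ σ) (hM : M ∈ σ)
    (hmax : Maximal (fun S : PSubgroups p G => S.1 ≤ hull σ M) T) (hQ : NormalIn σ Q) : Q ≤ M := by
  by_contra hQM
  -- The least member `E` beyond `M` would lie in the hull and contain `T`, so maximality would give
  -- `T = E ∈ σ`.
  obtain ⟨E, hE⟩ := (σ.filter fun P => ¬ P ≤ M).exists_minimal ⟨Q, by simp [hQ.1, hQM]⟩
  have hEσ : E ∈ σ ∧ ¬ E ≤ M := by simpa using hE.1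
  have hle : ∀ P ∈ σ, ¬ P ≤ M → E ≤ P := fun P hP hPM =>
    (hσ.total hEσ.1 hP).elim id fun h => hE.2 (by simp [hP, hPM]) h
  have hEn := hQ.mono hEσ.1 (hle Q hQ.1 hQM)
  have hME : M ≤ E := (hσ.total hM hEσ.1).elim id fun h => absurd h hEσ.2
  have hEh : E.1 ≤ hull σ M := le_hull_iff.2 fun P hP =>
    ⟨fun h => hEn.2 P hP (h.trans hME), fun h => hle P hP h⟩
  have hTE : T ≤ E := (le_hull_iff.1 hmax.1 E hEσ.1).2 hEσ.2
  exact hTσ (le_antisymm hTE (hmax.2 hEh hTE) ▸ hEσ.1)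

/-- The largest order of a member of `σ` which normalizes everything below it. -/
noncomputable def level (σ : Finset (PSubgroups p G)) : ℕ :=
  (σ.filter fun Q => NormalIn σ Q).sup fun Q => Nat.card Q.1

theorem card_le_level {Q : PSubgroups p G} (hQ : NormalIn σ Q) : Nat.card Q.1 ≤ level σ :=
  Finset.le_sup (f := fun Q : PSubgroups p G => Nat.card Q.1) (by simp [hQ, hQ.1])

theorem card_lt_card [Finite G] {P Q : PSubgroups p G} (h : P < Q) :
    Nat.card P.1 < Nat.card Q.1 := by
  refine lt_of_le_of_ne (Subgroup.card_le_of_le h.le) fun he => h.ne ?_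
  exact Subtype.ext (Subgroup.eq_of_le_of_card_ge h.le he.ge)

theorem level_lt_card_apex [Finite G] (hσ : IsChain (· ≤ ·) (σ : Set (PSubgroups p G)))
    {T : PSubgroups p G} (hT : IsApex σ T) : level σ < Nat.card T.1 := by
  obtain ⟨hTσ, M, hM, hMT, hmax⟩ := hT
  refine lt_of_le_of_lt (Finset.sup_le fun Q hQ => ?_) (card_lt_card hMT)
  exact Subgroup.card_le_of_le
    (le_base_of_normalIn hσ hTσ hM hmax (by simpa using (Finset.mem_filter.1 hQ).2))

theorem IsApex.le_or_le {T : PSubgroups p G} (hT : IsApex σ T) {P : PSubgroups p G} (hP : P ∈ σ) :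
    (P ≤ T ∧ T.1 ≤ MulAction.stabilizer G P) ∨ T ≤ P := by
  obtain ⟨_, M, hM, hMT, hmax⟩ := hT
  have h := le_hull_iff.1 hmax.1 P hP
  by_cases hPM : P ≤ M
  · exact Or.inl ⟨hPM.trans hMT.le, h.1 hPM⟩
  · exact Or.inr (h.2 hPM)

theorem IsApex.isChain_insert (hσ : IsChain (· ≤ ·) (σ : Set (PSubgroups p G)))
    {T : PSubgroups p G} (hT : IsApex σ T) :
    IsChain (· ≤ ·) ((insert T σ : Finset (PSubgroups p G)) : Set (PSubgroups p G)) := by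
  rw [Finset.coe_insert]
  exact hσ.insert fun P hP _ => (hT.le_or_le hP).elim (fun h => Or.inr h.1) Or.inl

theorem IsApex.normalIn {T : PSubgroups p G} (hT : IsApex σ T)
    {ρ : Finset (PSubgroups p G)} (hρ : ρ ⊆ insert T σ) (hTρ : T ∈ ρ) : NormalIn ρ T := by
  refine ⟨hTρ, fun P hP hPT => ?_⟩
  rcases Finset.mem_insert.1 (hρ hP) with rfl | hP
  · exact P.le_stabilizer_self
  · rcases hT.le_or_le hP with h | h
    · exact h.2
    · rw [le_antisymm hPT h]
      exact T.le_stabilizer_self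

/-- Along the matching of chains with their apices the level increases. -/
theorem level_lt_level [Finite G] (hσ : IsChain (· ≤ ·) (σ : Set (PSubgroups p G)))
    {T : PSubgroups p G} (hT : IsApex σ T) {ρ : Finset (PSubgroups p G)} (hρ : ρ ⊆ insert T σ)
    (hcard : σ.card ≤ ρ.card) (hne : ρ ≠ σ) : level σ < level ρ := by
  -- Here `T ∈ ρ`: otherwise `ρ ⊆ σ`, and the cardinalities force equality.
  refine (level_lt_card_apex hσ hT).trans_le (card_le_level (hT.normalIn hρ ?_))
  by_contra hTρ
  exact hne (Finset.eq_of_subset_of_card_le ((Finset.subset_insert_iff_of_notMem hTρ).1 hρ) hcard)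

/-- No chain is both the lower and the upper half of a pair: in `insert T σ` the base is `T` itself,
so a further apex would lie in the hull for `σ` and exceed `T`. -/
theorem IsApex.not_isApex_insert (hσ : IsChain (· ≤ ·) (σ : Set (PSubgroups p G)))
    {T T' : PSubgroups p G} (hT : IsApex σ T) : ¬ IsApex (insert T σ) T' := by
  intro hT'
  have hc := hT.isChain_insert hσ
  obtain ⟨hTσ', M', hM', hMT', hmax'⟩ := hT'
  have hTM' : T ≤ M' := le_base_of_normalIn hc hTσ' hM' hmax'
    (hT.normalIn subset_rfl (Finset.mem_insert_self _ _))
  have hN := normalIn_base hM' hMT' hmax'.1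
  obtain ⟨hTσ, M, hM, hMT, hmax⟩ := hT
  have hM'T : M' = T := by
    refine (Finset.mem_insert.1 hM').resolve_right fun h => ?_
    have : NormalIn σ M' := ⟨h, fun P hP => hN.2 P (Finset.mem_insert_of_mem hP)⟩
    exact hMT.not_ge (hTM'.trans (le_base_of_normalIn hσ hTσ hM hmax this))
  subst hM'T
  refine hMT'.not_ge (hmax.2 (le_hull_iff.2 fun P hP => ?_) hMT'.le)
  have h' := le_hull_iff.1 hmax'.1 P (Finset.mem_insert_of_mem hP)
  refine ⟨fun h => h'.1 (h.trans hMT.le), fun h => h'.2 fun hle => ?_⟩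
  have heq := le_antisymm hle ((le_hull_iff.1 hmax.1 P hP).2 h)
  exact hTσ (by rwa [heq] at hP)

/-- Maximal `p`-subgroups of `H` are its Sylow subgroups, hence conjugate in `H`. -/
theorem exists_smul_eq_of_maximal [Finite G] [Fact p.Prime] {H : Subgroup G} {T T' : PSubgroups p G}
    (hT : Maximal (fun S : PSubgroups p G => S.1 ≤ H) T)
    (hT' : Maximal (fun S : PSubgroups p G => S.1 ≤ H) T') : ∃ g ∈ H, g • T = T' := by
  have mk : ∀ {T : PSubgroups p G}, Maximal (fun S : PSubgroups p G => S.1 ≤ H) T →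
      ∃ P : Sylow p H, P.1 = T.1.subgroupOf H := by
    intro T hT
    refine ⟨⟨T.1.subgroupOf H, T.2.1.comap_subtype, fun {Q} hQ hle => ?_⟩, rfl⟩
    have hTQ : T.1 ≤ Q.map H.subtype := by
      rw [← Subgroup.map_subgroupOf_eq_of_le hT.1]
      exact Subgroup.map_mono hle
    have := hT.2 (y := ⟨Q.map H.subtype, hQ.map _, fun hb => T.2.2 (le_bot_iff.1 (hTQ.trans hb.le))⟩)
      (Subgroup.map_subtype_le Q) hTQ
    refine le_antisymm (fun x hx => ?_) hle
    exact this ⟨x, hx, rfl⟩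
  obtain ⟨P, hP⟩ := mk hT
  obtain ⟨P', hP'⟩ := mk hT'
  obtain ⟨h, hh⟩ := MulAction.exists_smul_eq H P P'
  refine ⟨h, h.2, Subtype.ext (SetLike.ext fun x => ?_)⟩
  have hTH : T.1 ≤ H := hT.1
  have hTH' : T'.1 ≤ H := hT'.1
  have key : ∀ x : H, x ∈ T'.1.subgroupOf H ↔ h⁻¹ * x * h ∈ T.1.subgroupOf H := by
    intro x
    rw [← hP, ← hP', ← hh]
    rw [Sylow.coe_subgroup_smul, Subgroup.mem_pointwise_smul_iff_inv_smul_mem, ← map_inv,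
      MulAut.smul_def, MulAut.conj_apply, inv_inv]
  rw [coe_smul, Subgroup.mem_pointwise_smul_iff_inv_smul_mem, ← map_inv,
      MulAut.smul_def, MulAut.conj_apply, inv_inv]
  constructor
  · intro hx
    have hxH : x ∈ H := by
      have := H.mul_mem (H.mul_mem h.2 (hTH hx)) (H.inv_mem h.2)
      simpa [mul_assoc] using this
    exact (key ⟨x, hxH⟩).2 hx
  · intro hx
    exact (key ⟨x, hTH' hx⟩).1 hx

theorem IsApex.exists_smul_eq [Finite G] [Fact p.Prime]
    (hσ : IsChain (· ≤ ·) (σ : Set (PSubgroups p G)))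
    {T T' : PSubgroups p G} (hT : IsApex σ T) (hT' : IsApex σ T') :
    ∃ g : G, g • σ = σ ∧ g • T = T' := by
  obtain ⟨hTσ, M, hM, hMT, hmax⟩ := hT
  obtain ⟨hTσ', M', hM', hMT', hmax'⟩ := hT'
  have hMM : M' = M := le_antisymm
    (le_base_of_normalIn hσ hTσ hM hmax (normalIn_base hM' hMT' hmax'.1))
    (le_base_of_normalIn hσ hTσ' hM' hmax' (normalIn_base hM hMT hmax.1))
  subst hMM
  obtain ⟨g, hg, hgT⟩ := exists_smul_eq_of_maximal hmax hmax'
  refine ⟨g, ?_, hgT⟩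
  have : ∀ P ∈ σ, g • P = P := fun P hP => hull_le_stabilizer hP hg
  exact (Finset.image_congr fun P hP => this P hP).trans Finset.image_id

/-- Every chain has an apex, or arises from a shorter chain by adding an apex, or consists of a
single maximal `p`-subgroup. -/
theorem isApex_trichotomy [Finite G] [Fact p.Prime] (hne : σ.Nonempty)
    (hσ : IsChain (· ≤ ·) (σ : Set (PSubgroups p G))) :
    (∃ T, IsApex σ T) ∨
    (∃ M ∈ σ, (σ.erase M).Nonempty ∧ IsApex (σ.erase M) M) ∨
    ∃ M : PSubgroups p G, IsMax M ∧ σ = {M} := by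
  have hgood : (σ.filter fun Q => NormalIn σ Q).Nonempty := by
    obtain ⟨Q, hQ⟩ := σ.exists_minimal hne
    refine ⟨Q, Finset.mem_filter.2 ⟨hQ.1, hQ.1, fun P hP hPQ => ?_⟩⟩
    rw [le_antisymm hPQ (hQ.2 hP hPQ)]
    exact Q.le_stabilizer_self
  obtain ⟨M, hMmax⟩ := (σ.filter fun Q => NormalIn σ Q).exists_maximal hgood
  have hMN : NormalIn σ M := (Finset.mem_filter.1 hMmax.1).2
  have hMtop : ∀ Q, NormalIn σ Q → Q ≤ M := fun Q hQ =>
    (hσ.total hQ.1 hMN.1).elim id fun h => hMmax.2 (Finset.mem_filter.2 ⟨hQ.1, hQ⟩) h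
  have hMh : M.1 ≤ hull σ M := le_hull_iff.2 fun P hP =>
    ⟨hMN.2 P hP, fun h => (hσ.total hMN.1 hP).resolve_right h⟩
  -- If `T` is new, it is an apex. Otherwise it normalizes everything below it in `σ`, so `T = M`
  -- and `M` is already maximal in its hull.
  obtain ⟨T, hMT, hT⟩ := Set.Finite.exists_le_maximal
    (Set.toFinite {S : PSubgroups p G | S.1 ≤ hull σ M}) hMh
  by_cases hTσ : T ∈ σ
  swap
  · exact Or.inl ⟨T, hTσ, M, hMN.1, lt_of_le_of_ne hMT fun h => hTσ (h ▸ hMN.1), hT⟩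
  have hTN : NormalIn σ T := by
    refine ⟨hTσ, fun P hP hPT => ?_⟩
    have h := le_hull_iff.1 hT.1 P hP
    by_cases hPM : P ≤ M
    · exact h.1 hPM
    · rw [le_antisymm hPT (h.2 hPM)]
      exact T.le_stabilizer_self
  obtain rfl : M = T := le_antisymm hMT (hMtop T hTN)
  -- No condition on normalizing `M` is needed: a counterexample `S` contains some `S' > M`
  -- normalizing `M`, and `S'` would lie in the hull, against the maximality of `M`.
  have grow : ∀ S : PSubgroups p G, M < S →
      ∃ P ∈ σ, ¬ ((P < M → S.1 ≤ MulAction.stabilizer G P) ∧ (¬ P ≤ M → S ≤ P)) := by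
    intro S hMS
    by_contra! hcon
    obtain ⟨S', hMS', hS'S, hS'⟩ := exists_lt_le_stabilizer hMS
    refine hMS'.not_ge (hT.2 (le_hull_iff.2 fun P hP => ⟨fun hPM => ?_, fun hPM => ?_⟩) hMS'.le)
    · rcases hPM.eq_or_lt with rfl | hPM
      · exact hS'
      · exact le_trans (show S'.1 ≤ S.1 from hS'S) ((hcon P hP).1 hPM)
    · exact hS'S.trans ((hcon P hP).2 hPM)
  right
  by_cases hlow : (σ.filter fun P => P < M).Nonempty
  · left
    -- The predecessor `M'` of `M` is the base that makes `M` an apex of `σ.erase M`.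
    obtain ⟨M', hM'⟩ := (σ.filter fun P => P < M).exists_maximal hlow
    have hM'σ : M' ∈ σ ∧ M' < M := by simpa using hM'.1
    have hle : ∀ P ∈ σ, P < M → P ≤ M' := fun P hP hPM =>
      (hσ.total hP hM'σ.1).elim id fun h => hM'.2 (by simp [hP, hPM]) h
    have hM'e : M' ∈ σ.erase M := Finset.mem_erase.2 ⟨hM'σ.2.ne, hM'σ.1⟩
    refine ⟨M, hMN.1, ⟨M', hM'e⟩, Finset.notMem_erase _ _, M', hM'e, hM'σ.2,
      le_hull_iff.2 fun P hP => ?_, fun S hS hMS => ?_⟩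
    · have hP := Finset.mem_erase.1 hP
      refine ⟨fun h => hMN.2 P hP.2 (h.trans hM'σ.2.le), fun h => ?_⟩
      exact (hσ.total hMN.1 hP.2).elim id fun h' =>
        absurd (hle P hP.2 (lt_of_le_of_ne h' hP.1)) h
    · by_contra hSM
      obtain ⟨P, hP, hPS⟩ := grow S (lt_of_le_not_ge hMS hSM)
      refine hPS ⟨fun hPM => ?_, fun hPM => ?_⟩
      · exact (le_hull_iff.1 hS P (Finset.mem_erase.2 ⟨hPM.ne, hP⟩)).1 (hle P hP hPM)
      · refine (le_hull_iff.1 hS P (Finset.mem_erase.2 ⟨?_, hP⟩)).2 fun h =>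
          hPM (h.trans hM'σ.2.le)
        rintro rfl
        exact hPM le_rfl
  · right
    have hlow : ∀ P ∈ σ, ¬ P < M := fun P hP h => hlow ⟨P, by simp [hP, h]⟩
    have hsingle : σ = {M} := by
      refine Finset.eq_singleton_iff_unique_mem.2 ⟨hMN.1, fun P hP => ?_⟩
      by_contra hPM
      -- With nothing in `σ` below `M`, the least member `E` beyond `M` is what `grow` forbids.
      obtain ⟨E, hE⟩ := (σ.filter fun P => ¬ P ≤ M).exists_minimal
        ⟨P, Finset.mem_filter.2 ⟨hP, fun h => hlow P hP (lt_of_le_of_ne h hPM)⟩⟩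
      have hEσ : E ∈ σ ∧ ¬ E ≤ M := by simpa using hE.1
      have hME : M < E := lt_of_le_not_ge ((hσ.total hEσ.1 hMN.1).resolve_left hEσ.2) hEσ.2
      obtain ⟨Q, hQ, hQE⟩ := grow E hME
      refine hQE ⟨fun h => absurd h (hlow Q hQ), fun h => ?_⟩
      exact (hσ.total hEσ.1 hQ).elim id fun h' => hE.2 (by simp [hQ, h]) h'
    refine ⟨M, fun S hMS => ?_, hsingle⟩
    by_contra hSM
    obtain ⟨P, hP, hPS⟩ := grow S (lt_of_le_not_ge hMS hSM)
    rw [hsingle, Finset.mem_singleton] at hP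
    subst hP
    exact hPS ⟨fun h => absurd h (lt_irrefl _), fun h => absurd le_rfl h⟩

theorem exists_smul_eq_of_isMax [Finite G] [Fact p.Prime] {M M' : PSubgroups p G} (h : IsMax M)
    (h' : IsMax M') : ∃ g : G, g • M = M' := by
  obtain ⟨g, _, hg⟩ := exists_smul_eq_of_maximal (H := ⊤) (T := M) (T' := M')
    ⟨le_top, fun _ _ hS => h hS⟩ ⟨le_top, fun _ _ hS => h' hS⟩
  exact ⟨g, hg⟩

theorem not_isApex_of_isMax {M T : PSubgroups p G} (h : IsMax M) : ¬ IsApex {M} T := by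
  rintro ⟨-, M', hM', hMT, -⟩
  rw [Finset.mem_singleton] at hM'
  exact h.not_lt (hM' ▸ hMT)

theorem nonempty_of_dvd_card [Finite G] [Fact p.Prime] (h : p ∣ Nat.card G) :
    Nonempty (PSubgroups p G) := by
  obtain ⟨P⟩ : Nonempty (Sylow p G) := inferInstance
  exact ⟨P.1, P.2, P.ne_bot_of_dvd_card h⟩

end Chain

/-! ### Invariant subcomplexes and their collapses -/

/-- A `G`-invariant subcomplex of the order complex of `S_p(G)` which contains the maximal
`p`-subgroups and, with each chain, its extensions by an apex. -/
structure ApexClosed (L : Finset (Finset (PSubgroups p G))) : Prop where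
  nonempty : ∀ s ∈ L, s.Nonempty
  isChain : ∀ s ∈ L, IsChain (· ≤ ·) (s : Set (PSubgroups p G))
  down : ∀ s ∈ L, ∀ t ⊆ s, t.Nonempty → t ∈ L
  smul : ∀ s ∈ L, ∀ g : G, g • s ∈ L
  apex : ∀ s ∈ L, ∀ T, IsApex s T → insert T s ∈ L
  singleton : ∀ M : PSubgroups p G, IsMax M → {M} ∈ L

/-- If two different facets of one simplex were both matched with it, each would have a smaller
`level` than the other. -/
theorem IsApex.unique [Finite G] {σ σ' : Finset (PSubgroups p G)} {T T' : PSubgroups p G}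
    (hσ : IsChain (· ≤ ·) (σ : Set (PSubgroups p G)))
    (hσ' : IsChain (· ≤ ·) (σ' : Set (PSubgroups p G))) (hT : IsApex σ T) (hT' : IsApex σ' T')
    (h : insert T σ = insert T' σ') : σ = σ' := by
  by_contra hne
  have hc : σ.card = σ'.card := by
    have := congrArg Finset.card h
    rw [Finset.card_insert_of_notMem hT.1, Finset.card_insert_of_notMem hT'.1] at this
    omega
  exact lt_asymm
    (level_lt_level hσ hT (h ▸ Finset.subset_insert T' σ') hc.le (Ne.symm hne))
    (level_lt_level hσ' hT' (h ▸ Finset.subset_insert T σ) hc.ge hne)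

/-- If some chain of `L` has an apex, then there is one which is a free face up to conjugation. -/
theorem ApexClosed.exists_free [Finite G] [Fact p.Prime] {L : Finset (Finset (PSubgroups p G))}
    (hL : ApexClosed L) (h : ∃ σ ∈ L, ∃ T, IsApex σ T) :
    ∃ σ ∈ L, ∃ T, IsApex σ T ∧ (∀ s ∈ L, s.card ≤ σ.card + 1) ∧
      ∀ s ∈ L, σ ⊂ s → ∃ T', IsApex σ T' ∧ s = insert T' σ := by
  obtain ⟨σ₁, hσ₁, hT₁⟩ := h
  -- Choose `σ` of maximal cardinality among the chains with an apex, then of minimal level. Larger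
  -- chains have no apex, so they arise by adding one.
  obtain ⟨σ₂, hσ₂, hmax⟩ := (L.filter fun σ => ∃ T, IsApex σ T).exists_max_image Finset.card
    ⟨σ₁, Finset.mem_filter.2 ⟨hσ₁, hT₁⟩⟩
  obtain ⟨σ, hσ, hmin⟩ :=
    (L.filter fun σ => (∃ T, IsApex σ T) ∧ σ.card = σ₂.card).exists_min_image level
      ⟨σ₂, Finset.mem_filter.2
        ⟨(Finset.mem_filter.1 hσ₂).1, (Finset.mem_filter.1 hσ₂).2, rfl⟩⟩
  obtain ⟨hσL, ⟨T, hT⟩, hcard⟩ := Finset.mem_filter.1 hσ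
  have hmax' : ∀ s ∈ L, (∃ T, IsApex s T) → s.card ≤ σ.card := fun s hs hsT =>
    hcard ▸ hmax s (Finset.mem_filter.2 ⟨hs, hsT⟩)
  have hpos : 1 ≤ σ.card := (hL.nonempty σ hσL).card_pos
  have hbig : ∀ s ∈ L, σ.card < s.card → ∃ M ∈ s, IsApex (s.erase M) M ∧ s.erase M ∈ L := by
    intro s hs hlt
    rcases isApex_trichotomy (hL.nonempty s hs) (hL.isChain s hs) with h | ⟨M, hM, hne, h⟩ |
      ⟨M, -, rfl⟩
    · exact absurd (hmax' s hs h) hlt.not_ge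
    · exact ⟨M, hM, h, hL.down s hs _ (Finset.erase_subset _ _) hne⟩
    · rw [Finset.card_singleton] at hlt
      omega
  have hle : ∀ s ∈ L, s.card ≤ σ.card + 1 := by
    intro s hs
    by_contra! hlt
    obtain ⟨M, hM, hap, hmem⟩ := hbig s hs (by omega)
    have := hmax' _ hmem ⟨M, hap⟩
    rw [Finset.card_erase_of_mem hM] at this
    omega
  refine ⟨σ, hσL, T, hT, hle, fun s hs hss => ?_⟩
  have hlt := Finset.card_lt_card hss
  obtain ⟨M, hM, hap, hmem⟩ := hbig s hs hlt
  have hc : (s.erase M).card = σ.card := by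
    have := hle s hs
    rw [Finset.card_erase_of_mem hM]
    omega
  by_cases he : σ = s.erase M
  · exact ⟨M, he ▸ hap, by rw [he, Finset.insert_erase hM]⟩
  -- Otherwise the facet `s.erase M`, also matched and of the same size, would have a smaller level
  -- than `σ`.
  · have h1 := level_lt_level (hL.isChain _ hmem) hap (ρ := σ)
      (by rw [Finset.insert_erase hM]; exact hss.subset) hc.le he
    have h2 := hmin (s.erase M) (Finset.mem_filter.2 ⟨hmem, ⟨M, hap⟩, hc.trans hcard⟩)
    exact absurd h1 h2.not_gt

/-- Removal of the orbits of `σ` and `insert T σ` from a family of chains. -/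
noncomputable def collapse (L : Finset (Finset (PSubgroups p G))) (σ : Finset (PSubgroups p G))
    (T : PSubgroups p G) : Finset (Finset (PSubgroups p G)) :=
  L.filter fun s => (∀ g : G, s ≠ g • σ) ∧ ∀ g : G, s ≠ g • insert T σ

theorem mem_collapse {L : Finset (Finset (PSubgroups p G))} {σ s : Finset (PSubgroups p G)}
    {T : PSubgroups p G} : s ∈ collapse L σ T ↔
      s ∈ L ∧ (∀ g : G, s ≠ g • σ) ∧ ∀ g : G, s ≠ g • insert T σ :=
  Finset.mem_filter

/-- Freeness of `σ` keeps the family closed under faces; closure under apices survives because both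
halves of a matched pair are removed together. -/
theorem ApexClosed.collapse [Finite G] [Fact p.Prime] {L : Finset (Finset (PSubgroups p G))}
    (hL : ApexClosed L) {σ : Finset (PSubgroups p G)} {T : PSubgroups p G} (hσ : σ ∈ L)
    (hT : IsApex σ T) (hcard : ∀ s ∈ L, s.card ≤ σ.card + 1)
    (hfree : ∀ s ∈ L, σ ⊂ s → ∃ T', IsApex σ T' ∧ s = insert T' σ) :
    ApexClosed (collapse L σ T) where
  nonempty s hs := hL.nonempty s (mem_collapse.1 hs).1
  isChain s hs := hL.isChain s (mem_collapse.1 hs).1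
  down s hs t hts ht := by
    obtain ⟨hsL, h1, h2⟩ := mem_collapse.1 hs
    refine mem_collapse.2 ⟨hL.down s hsL t hts ht, ?_, ?_⟩
    · rintro g rfl
      have hsub : σ ⊆ g⁻¹ • s := by
        rw [Finset.subset_smul_finset_iff, inv_inv]
        exact hts
      -- A chain properly containing a conjugate of `σ` adds a conjugate apex to it, so it was
      -- removed as well.
      rcases hsub.eq_or_ssubset with he | hss
      · exact h1 g (by rw [he, smul_inv_smul])
      · obtain ⟨T', hT', he⟩ := hfree _ (hL.smul s hsL g⁻¹) hss
        obtain ⟨k, hkσ, hkT⟩ := hT.exists_smul_eq (hL.isChain σ hσ) hT'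
        refine h2 (g * k) ?_
        rw [mul_smul, Finset.smul_finset_insert, hkσ, hkT, ← he, smul_inv_smul]
    · rintro g rfl
      refine h2 g (Finset.eq_of_subset_of_card_le hts ?_).symm
      rw [Finset.card_smul_finset, Finset.card_insert_of_notMem hT.1]
      exact hcard s hsL
  smul s hs g := by
    obtain ⟨hsL, h1, h2⟩ := mem_collapse.1 hs
    refine mem_collapse.2 ⟨hL.smul s hsL g, fun k hk => h1 (g⁻¹ * k) ?_,
      fun k hk => h2 (g⁻¹ * k) ?_⟩ <;> rw [mul_smul, ← hk, inv_smul_smul]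
  apex s hs S hS := by
    obtain ⟨hsL, h1, h2⟩ := mem_collapse.1 hs
    refine mem_collapse.2 ⟨hL.apex s hsL S hS, fun g hg => ?_, fun g hg => ?_⟩
    · exact hS.not_isApex_insert (hL.isChain s hsL) (hg ▸ hT.smul g)
    · refine h1 g (hS.unique (hL.isChain s hsL) (hL.isChain _ (hL.smul σ hσ g)) (hT.smul g) ?_)
      rw [hg, Finset.smul_finset_insert]
  singleton M hM := by
    refine mem_collapse.2 ⟨hL.singleton M hM, fun g hg => ?_, fun g hg => ?_⟩
    · exact not_isApex_of_isMax hM (hg ▸ hT.smul g)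
    · have h := congrArg Finset.card hg
      have := (hL.nonempty σ hσ).card_pos
      rw [Finset.card_smul_finset, Finset.card_insert_of_notMem hT.1, Finset.card_singleton] at h
      omega

theorem collapse_ssubset {L : Finset (Finset (PSubgroups p G))} {σ : Finset (PSubgroups p G)}
    {T : PSubgroups p G} (hσ : σ ∈ L) : collapse L σ T ⊂ L :=
  Finset.filter_ssubset.2 ⟨σ, hσ, fun h => h.1 1 (one_smul G σ).symm⟩

theorem eq_of_smul_finset_eq [Finite G] {s : Finset (PSubgroups p G)}
    (hs : IsChain (· ≤ ·) (s : Set (PSubgroups p G))) {g : G} (hg : g • s = s)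
    {P : PSubgroups p G} (hP : P ∈ s) : g • P = P :=
  eq_of_smul_comparable (hs.total (hg ▸ Finset.smul_mem_smul_finset hP) hP)

end PSubgroups

/-! ### Supports and the orbit space -/

namespace PSubgroupComplex

open PSubgroups

variable {p : ℕ} {G : Type*} [Group G] [Finite G]

theorem continuous_coord (P : PSubgroups p G) :
    Continuous fun x : PSubgroupComplex p G => x.1 P :=
  (continuous_apply P).comp continuous_subtype_val

theorem smul_apply (g : G) (x : PSubgroupComplex p G) (P : PSubgroups p G) :
    (g • x).1 P = x.1 (g⁻¹ • P) := rfl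

instance : ContinuousConstSMul G (PSubgroupComplex p G) where
  continuous_const_smul g :=
    Continuous.subtype_mk (continuous_pi fun P => continuous_coord (g⁻¹ • P)) _

instance : T2Space (PSubgroupComplex p G) :=
  inferInstanceAs (T2Space {_x : PSubgroups p G → ℝ // _})

instance : CompactSpace (PSubgroupComplex p G) := by
  refine (isCompact_iff_compactSpace (s := {x : PSubgroups p G → ℝ | x ∈ stdSimplex ℝ _ ∧
    ∃ s ∈ (orderComplex (PSubgroups p G)).faces, Function.support x ⊆ (s : Set _)})).mp ?_
  refine (isCompact_stdSimplex ℝ (PSubgroups p G)).inter_right (t := {x | ∃ s ∈ _, _}) ?_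
  have : {x : PSubgroups p G → ℝ | ∃ s ∈ (orderComplex (PSubgroups p G)).faces,
      Function.support x ⊆ (s : Set _)} =
      ⋃ s ∈ (orderComplex (PSubgroups p G)).faces, ⋂ P ∈ (s : Set (PSubgroups p G))ᶜ,
        {x | x P = 0} := by
    ext x
    simp only [Set.mem_ofPred_eq, Set.mem_iUnion, Set.mem_iInter, Function.support_subset_iff',
      exists_prop, Set.mem_compl_iff]
  rw [this]
  refine Set.Finite.isClosed_biUnion (Set.toFinite _) fun s _ => ?_
  exact isClosed_biInter fun P _ => isClosed_eq (continuous_apply P) continuous_const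

/-- The gluing lemma requires a Hausdorff ambient space. -/
instance : T2Space (MulAction.orbitRel.Quotient G (PSubgroupComplex p G)) :=
  t2Space_of_properlyDiscontinuousSMul_of_t2Space

/-- The vertices of the smallest simplex containing `x`. -/
noncomputable def supp (x : PSubgroupComplex p G) : Finset (PSubgroups p G) :=
  Finset.univ.filter fun P => x.1 P ≠ 0

theorem mem_supp {x : PSubgroupComplex p G} {P : PSubgroups p G} : P ∈ supp x ↔ x.1 P ≠ 0 := by
  simp [supp]

theorem supp_subset_iff {x : PSubgroupComplex p G} {s : Finset (PSubgroups p G)} :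
    supp x ⊆ s ↔ ∀ P ∉ s, x.1 P = 0 := by
  refine ⟨fun h P hP => ?_, fun h P hP => ?_⟩ <;> by_contra hc
  · exact hP (h (mem_supp.2 hc))
  · exact mem_supp.1 hP (h P hc)

theorem supp_nonempty (x : PSubgroupComplex p G) : (supp x).Nonempty := by
  by_contra h
  have h0 : ∀ P, x.1 P = 0 := fun P => supp_subset_iff.1
    (Finset.not_nonempty_iff_eq_empty.1 h).subset P (Finset.notMem_empty P)
  have := x.2.1.2
  simp [h0] at this

theorem isChain_supp (x : PSubgroupComplex p G) :
    IsChain (· ≤ ·) (supp x : Set (PSubgroups p G)) := by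
  obtain ⟨s, hs, hxs⟩ := x.2.2
  exact hs.2.mono fun P hP => hxs (mem_supp.1 hP)

theorem supp_smul (g : G) (x : PSubgroupComplex p G) : supp (g • x) = g • supp x := by
  ext P
  rw [mem_supp, smul_apply, ← mem_supp, Finset.inv_smul_mem_iff]

theorem isClosed_supp_subset (s : Finset (PSubgroups p G)) :
    IsClosed {x : PSubgroupComplex p G | supp x ⊆ s} := by
  simp only [supp_subset_iff, Set.ofPred_forall]
  exact isClosed_iInter fun P => isClosed_iInter fun _ =>
    isClosed_eq (continuous_coord P) continuous_const

/-- The projection of the subcomplex `L` to the orbit space. -/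
def orbitImage (L : Finset (Finset (PSubgroups p G))) :
    Set (MulAction.orbitRel.Quotient G (PSubgroupComplex p G)) :=
  Quotient.mk _ '' {x | supp x ∈ L}

theorem mk_eq_mk_iff {x y : PSubgroupComplex p G} :
    (Quotient.mk _ x : MulAction.orbitRel.Quotient G (PSubgroupComplex p G)) = Quotient.mk _ y ↔
      ∃ g : G, g • y = x :=
  Quotient.eq.trans Iff.rfl

theorem mk_smul (g : G) (x : PSubgroupComplex p G) :
    (Quotient.mk _ (g • x) : MulAction.orbitRel.Quotient G (PSubgroupComplex p G)) =
      Quotient.mk _ x :=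
  mk_eq_mk_iff.2 ⟨g, rfl⟩

theorem mk_mem_orbitImage {L : Finset (Finset (PSubgroups p G))} (hL : ApexClosed L)
    {x : PSubgroupComplex p G} : Quotient.mk _ x ∈ orbitImage L ↔ supp x ∈ L := by
  refine ⟨?_, fun h => ⟨x, h, rfl⟩⟩
  rintro ⟨y, hy, hyx⟩
  obtain ⟨g, rfl⟩ := mk_eq_mk_iff.1 hyx.symm
  exact supp_smul g y ▸ hL.smul _ hy g

theorem isCompact_orbitImage {L : Finset (Finset (PSubgroups p G))} (hL : ApexClosed L) :
    IsCompact (orbitImage L) := by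
  refine IsCompact.image (IsClosed.isCompact ?_) continuous_quotient_mk'
  have : {x : PSubgroupComplex p G | supp x ∈ L} = ⋃ s ∈ L, {x | supp x ⊆ s} := by
    ext x
    simp only [Set.mem_ofPred_eq, Set.mem_iUnion, exists_prop]
    exact ⟨fun h => ⟨_, h, subset_rfl⟩, fun ⟨s, hs, hxs⟩ => hL.down s hs _ hxs (supp_nonempty x)⟩
  rw [this]
  exact L.finite_toSet.isClosed_biUnion fun s _ => isClosed_supp_subset s

/-! ### Pushing a simplex onto a horn -/

/-- The smallest barycentric coordinate of `x` on the simplex `σ`. -/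
noncomputable def minCoord {σ : Finset (PSubgroups p G)} (hσ : σ.Nonempty)
    (x : PSubgroupComplex p G) : ℝ :=
  σ.inf' hσ x.1

theorem continuous_minCoord {σ : Finset (PSubgroups p G)} (hσ : σ.Nonempty) :
    Continuous (minCoord hσ) :=
  Continuous.finset_inf'_apply hσ fun P _ => continuous_coord P

theorem minCoord_nonneg {σ : Finset (PSubgroups p G)} (hσ : σ.Nonempty)
    (x : PSubgroupComplex p G) : 0 ≤ minCoord hσ x :=
  Finset.le_inf' _ _ fun P _ => x.2.1.1 P

theorem minCoord_le {σ : Finset (PSubgroups p G)} (hσ : σ.Nonempty)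
    (x : PSubgroupComplex p G) {P : PSubgroups p G} (hP : P ∈ σ) : minCoord hσ x ≤ x.1 P :=
  Finset.inf'_le _ hP

/-- Coordinates of the point obtained by moving `x` away from the facet `σ` towards the vertex `T`,
decreasing the coordinates on `σ` by `c`. -/
noncomputable def pushCoord {ι : Type*} (σ : Finset (ι)) (T : ι)
    (x : ι → ℝ) (c : ℝ) (P : ι) : ℝ :=
  x P + c * ((if P = T then (σ.card : ℝ) else 0) - if P ∈ σ then 1 else 0)

theorem pushCoord_apply_of_mem {ι : Type*} {σ : Finset (ι)} {T : ι} (hT : T ∉ σ)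
    (x : ι → ℝ) (c : ℝ) {P : ι} (hP : P ∈ σ) :
    pushCoord σ T x c P = x P - c := by
  have : P ≠ T := fun h => hT (h ▸ hP)
  simp [pushCoord, this, hP, sub_eq_add_neg]

theorem pushCoord_zero {ι : Type*} (σ : Finset (ι)) (T : ι)
    (x : ι → ℝ) : pushCoord σ T x 0 = x := by
  ext P
  simp [pushCoord]

theorem sum_pushCoord {ι : Type*} [Fintype ι] (σ : Finset (ι)) (T : ι)
    (x : ι → ℝ) (c : ℝ) : ∑ P, pushCoord σ T x c P = ∑ P, x P := by
  simp [pushCoord, Finset.sum_add_distrib, ← Finset.mul_sum, Finset.sum_sub_distrib]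

theorem pushCoord_of_notMem {ι : Type*} {σ : Finset (ι)} {T : ι}
    (x : ι → ℝ) (c : ℝ) {P : ι} (hPT : P ≠ T) (hP : P ∉ σ) :
    pushCoord σ T x c P = x P := by
  simp [pushCoord, hPT, hP]

theorem pushCoord_nonneg {ι : Type*} {σ : Finset (ι)} {T : ι} (hT : T ∉ σ)
    {x : ι → ℝ} (hx : ∀ P, 0 ≤ x P) {c : ℝ} (hc : 0 ≤ c) (hcσ : ∀ P ∈ σ, c ≤ x P)
    (P : ι) : 0 ≤ pushCoord σ T x c P := by
  by_cases hP : P ∈ σ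
  · rw [pushCoord_apply_of_mem hT x c hP]
    exact sub_nonneg.2 (hcσ P hP)
  · simp only [pushCoord, hP, if_false, sub_zero]
    have := hx P
    split_ifs <;> positivity

/-- The deformation of the simplex spanned by `σ` and `T` onto the union of its facets which
contain `T`. -/
theorem exists_horn_deformation {σ : Finset (PSubgroups p G)} (hσ : σ.Nonempty)
    {T : PSubgroups p G} (hT : T ∉ σ)
    (hchain : IsChain (· ≤ ·) ((insert T σ : Finset _) : Set (PSubgroups p G))) :
    ∃ H : C({x : PSubgroupComplex p G // supp x ⊆ insert T σ} × unitInterval,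
        {x : PSubgroupComplex p G // supp x ⊆ insert T σ}),
      (∀ x, H (x, 0) = x) ∧ (∀ x, ∃ P ∈ σ, (H (x, 1)).1.1 P = 0) ∧
      ∀ x, (∃ P ∈ σ, x.1.1 P = 0) → ∀ t, H (x, t) = x := by
  let D := {x : PSubgroupComplex p G // supp x ⊆ insert T σ}
  -- At time `1` the smallest coordinate on `σ` reaches `0`; on the horn that minimum is already
  -- `0`, so nothing moves.
  let c : D × unitInterval → ℝ := fun z => z.2 * minCoord hσ z.1.1
  have hc : Continuous c := (continuous_subtype_val.comp continuous_snd).mul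
    ((continuous_minCoord hσ).comp (continuous_subtype_val.comp continuous_fst))
  have hc0 : ∀ z, 0 ≤ c z := fun z => mul_nonneg z.2.2.1 (minCoord_nonneg hσ _)
  have hcσ : ∀ z, ∀ P ∈ σ, c z ≤ z.1.1.1 P := fun z P hP =>
    (mul_le_of_le_one_left (minCoord_nonneg hσ _) z.2.2.2).trans (minCoord_le hσ _ hP)
  have hsupp : ∀ z : D × unitInterval, ∀ P ∉ insert T σ, pushCoord σ T z.1.1.1 (c z) P = 0 :=
    fun z P hP => by
      have h := not_or.1 (Finset.mem_insert.not.1 hP)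
      rw [pushCoord_of_notMem _ _ h.1 h.2, supp_subset_iff.1 z.1.2 P hP]
  let h : D × unitInterval → PSubgroupComplex p G := fun z =>
    ⟨pushCoord σ T z.1.1.1 (c z),
      ⟨pushCoord_nonneg hT z.1.1.2.1.1 (hc0 z) (hcσ z),
        (sum_pushCoord _ _ _ _).trans z.1.1.2.1.2⟩,
      insert T σ, ⟨Finset.insert_nonempty _ _, hchain⟩,
      Function.support_subset_iff'.2 (hsupp z)⟩
  have hcont : Continuous h := by
    refine Continuous.subtype_mk (continuous_pi fun P => ?_) _
    exact ((continuous_coord P).comp (continuous_subtype_val.comp continuous_fst)).add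
      (hc.mul continuous_const)
  refine ⟨⟨fun z => ⟨h z, supp_subset_iff.2 (hsupp z)⟩, hcont.subtype_mk _⟩, fun x => ?_,
    fun x => ?_, fun x hx t => ?_⟩
  · refine Subtype.ext (Subtype.ext ?_)
    change pushCoord σ T x.1.1 (c (x, 0)) = x.1.1
    simp only [c, Set.Icc.coe_zero, zero_mul, pushCoord_zero]
  · obtain ⟨P, hP, he⟩ := σ.exists_mem_eq_inf' hσ x.1.1
    refine ⟨P, hP, ?_⟩
    change pushCoord σ T x.1.1 (c (x, 1)) P = 0
    rw [pushCoord_apply_of_mem hT _ _ hP, ← he]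
    simp [c, minCoord]
  · obtain ⟨P, hP, hx⟩ := hx
    have h0 : minCoord hσ x.1 = 0 :=
      le_antisymm ((minCoord_le hσ x.1 hP).trans hx.le) (minCoord_nonneg hσ x.1)
    refine Subtype.ext (Subtype.ext ?_)
    change pushCoord σ T x.1.1 (c (x, t)) = x.1.1
    simp only [c, h0, mul_zero, pushCoord_zero]

/-! ### Elementary collapses of the orbit space -/

/-- The closed simplex on `insert T σ` is glued along its horn, the faces omitting a vertex of `σ`.
Off the horn only the open simplices of `σ` and `insert T σ` remain. -/
theorem contractibleSpace_of_collapse [Fact p.Prime] {L : Finset (Finset (PSubgroups p G))}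
    (hL : ApexClosed L) {σ : Finset (PSubgroups p G)} {T : PSubgroups p G} (hσ : σ ∈ L)
    (hT : IsApex σ T) (hcard : ∀ s ∈ L, s.card ≤ σ.card + 1)
    (hfree : ∀ s ∈ L, σ ⊂ s → ∃ T', IsApex σ T' ∧ s = insert T' σ)
    (h : ContractibleSpace (orbitImage (collapse L σ T))) :
    ContractibleSpace (orbitImage L) := by
  have hL' := hL.collapse hσ hT hcard hfree
  have hσc := hL.isChain σ hσ
  have hτ := hL.apex σ hσ T hT
  obtain ⟨H, H0, H1, HΛ⟩ :=
    exists_horn_deformation (hL.nonempty σ hσ) hT.1 (hT.isChain_insert hσc)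
  have : CompactSpace {x : PSubgroupComplex p G // supp x ⊆ insert T σ} :=
    isCompact_iff_compactSpace.mp (isClosed_supp_subset (insert T σ)).isCompact
  have hfull : ∀ x : {x : PSubgroupComplex p G // supp x ⊆ insert T σ},
      (¬ ∃ P ∈ σ, x.1.1 P = 0) → supp x.1 = σ ∨ supp x.1 = insert T σ := by
    intro x hx
    push Not at hx
    have hsub : σ ⊆ supp x.1 := fun P hP => mem_supp.2 (hx P hP)
    by_cases hTx : T ∈ supp x.1
    · exact Or.inr (x.2.antisymm (Finset.insert_subset hTx hsub))
    · exact Or.inl (((Finset.subset_insert_iff_of_notMem hTx).1 x.2).antisymm hsub)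
  refine contractibleSpace_of_attach (isCompact_orbitImage hL')
    (f := fun x : {x : PSubgroupComplex p G // supp x ⊆ insert T σ} => Quotient.mk _ x.1)
    (Λ := {x | ∃ P ∈ σ, x.1.1 P = 0}) (continuous_quotient_mk'.comp continuous_subtype_val)
    ?_ ?_ ?_ H H0 H1 HΛ
  · refine Set.Subset.antisymm ?_ (Set.union_subset ?_ ?_)
    · rintro _ ⟨x, hx, rfl⟩
      by_cases hx' : supp x ∈ collapse L σ T
      · exact Or.inl ⟨x, hx', rfl⟩
      · right
        have : ∃ g : G, supp x ⊆ g • insert T σ := by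
          by_contra! hcon
          refine hx' (mem_collapse.2 ⟨hx, fun g hg => hcon g ?_, fun g hg => hcon g hg.subset⟩)
          rw [hg]
          exact Finset.smul_finset_subset_smul_finset (Finset.subset_insert _ _)
        obtain ⟨g, hg⟩ := this
        refine ⟨⟨g⁻¹ • x, ?_⟩, mk_smul g⁻¹ x⟩
        rw [supp_smul, Finset.smul_finset_subset_iff, inv_inv]
        exact hg
    · exact Set.image_mono fun x hx => (mem_collapse.1 hx).1
    · rintro _ ⟨x, rfl⟩
      exact ⟨x.1, hL.down _ hτ _ x.2 (supp_nonempty _), rfl⟩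
  · intro x
    rw [mk_mem_orbitImage hL']
    refine ⟨fun hx => ?_, fun ⟨P, hP, hx⟩ => ?_⟩
    · by_contra hx'
      obtain ⟨-, h1, h2⟩ := mem_collapse.1 hx
      rcases hfull x hx' with he | he
      · exact h1 1 (by rw [he, one_smul])
      · exact h2 1 (by rw [he, one_smul])
    · refine mem_collapse.2 ⟨hL.down _ hτ _ x.2 (supp_nonempty _), fun g hg => ?_, fun g hg => ?_⟩
      -- A horn face conjugate to `σ` would be another matched facet of `insert T σ`; uniqueness
      -- makes it `σ` itself, which omits no vertex of `σ`.
      · have hsub : σ ⊆ g⁻¹ • insert T σ := by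
          rw [Finset.subset_smul_finset_iff, inv_inv, ← hg]
          exact x.2
        have hss : σ ⊂ g⁻¹ • insert T σ := by
          refine hsub.ssubset_of_ne fun he => ?_
          have := congrArg Finset.card he
          rw [Finset.card_smul_finset, Finset.card_insert_of_notMem hT.1] at this
          omega
        obtain ⟨T', hT', he⟩ := hfree _ (hL.smul _ hτ g⁻¹) hss
        rw [Finset.smul_finset_insert] at he
        have := (hT.smul g⁻¹).unique (hL.isChain _ (hL.smul _ hσ _)) hσc hT' he
        refine mem_supp.1 ?_ hx
        rw [hg, ← inv_inv g, ← this, smul_smul]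
        simpa using hP
      · have he : supp x.1 = insert T σ := Finset.eq_of_subset_of_card_le x.2
          (by rw [hg, Finset.card_smul_finset])
        exact mem_supp.1 (by rw [he]; exact Finset.mem_insert_of_mem hP) hx
  · intro x hx y hy hxy
    obtain ⟨g, hg⟩ := mk_eq_mk_iff.1 hxy
    have hs : g • supp y.1 = supp x.1 := by rw [← supp_smul, hg]
    have hxy' : supp x.1 = supp y.1 := by
      have hc := congrArg Finset.card hs
      rw [Finset.card_smul_finset] at hc
      have := Finset.card_insert_of_notMem hT.1
      rcases hfull x hx with h1 | h1 <;> rcases hfull y hy with h2 | h2 <;> rw [h1, h2] at hc ⊢ <;>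
        omega
    refine Subtype.ext (Subtype.ext (funext fun P => ?_))
    by_cases hP : P ∈ supp x.1
    -- The supports agree, so `g` preserves this chain and fixes each vertex; the coordinates are
    -- therefore equal.
    · have hfix : g⁻¹ • P = P := by
        refine eq_of_smul_finset_eq (isChain_supp x.1) ?_ hP
        rw [inv_smul_eq_iff, hxy', hs, hxy']
      rw [← hg, smul_apply, hfix]
    · rw [supp_subset_iff.1 subset_rfl P hP, supp_subset_iff.1 subset_rfl P (hxy' ▸ hP)]

theorem eq_single {x : PSubgroupComplex p G} {M : PSubgroups p G} (h : supp x = {M}) :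
    x.1 = Pi.single M 1 := by
  have h0 : ∀ P, P ≠ M → x.1 P = 0 := fun P hP =>
    supp_subset_iff.1 h.subset P (by simpa using hP)
  have h1 : x.1 M = 1 := by
    rw [← x.2.1.2]
    exact (Finset.sum_eq_single M (fun P _ => h0 P) (by simp)).symm
  ext P
  by_cases hP : P = M
  · rw [hP, h1, Pi.single_eq_same]
  · rw [h0 P hP, Pi.single_eq_of_ne hP]

/-- Collapsing stops when no chain has an apex. Only single maximal `p`-subgroups are then left, and
they are all conjugate, so the image is a point. -/
theorem contractibleSpace_orbitImage [Fact p.Prime] [Nonempty (PSubgroups p G)]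
    (L : Finset (Finset (PSubgroups p G))) (hL : ApexClosed L) :
    ContractibleSpace (orbitImage L) := by
  induction L using Finset.strongInduction with
  | H L ih =>
    by_cases h : ∃ σ ∈ L, ∃ T, IsApex σ T
    · obtain ⟨σ, hσ, T, hT, hcard, hfree⟩ := hL.exists_free h
      exact contractibleSpace_of_collapse hL hσ hT hcard hfree
        (ih _ (collapse_ssubset hσ) (hL.collapse hσ hT hcard hfree))
    · have hsingle : ∀ s ∈ L, ∃ M : PSubgroups p G, IsMax M ∧ s = {M} := by
        intro s hs
        rcases isApex_trichotomy (hL.nonempty s hs) (hL.isChain s hs) with h' | ⟨M, hM, hne, h'⟩ |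
          h'
        · exact absurd ⟨s, hs, h'⟩ h
        · exact absurd ⟨_, hL.down s hs _ (Finset.erase_subset _ _) hne, M, h'⟩ h
        · exact h'
      obtain ⟨M, -, hM⟩ := Set.Finite.exists_le_maximal
        (Set.toFinite (Set.univ : Set (PSubgroups p G))) (Set.mem_univ (Classical.arbitrary _))
      have hM : IsMax M := fun P hP => hM.2 (Set.mem_univ P) hP
      let x : PSubgroupComplex p G := ⟨Pi.single M 1, single_mem_stdSimplex ℝ M, {M},
        (orderComplex (PSubgroups p G)).singleton_mem M, by
          rw [Finset.coe_singleton]; exact Pi.support_single_subset⟩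
      have hx : supp x = {M} := by
        ext P
        rw [mem_supp, Finset.mem_singleton]
        change (Pi.single M 1 : PSubgroups p G → ℝ) P ≠ 0 ↔ P = M
        simp [Pi.single_apply]
      have : Unique (orbitImage L) :=
        { default := ⟨Quotient.mk _ x, x, by simpa [hx] using hL.singleton M hM, rfl⟩
          uniq := by
            rintro ⟨_, y, hy, rfl⟩
            obtain ⟨M', hM', hyM⟩ := hsingle _ hy
            obtain ⟨g, rfl⟩ := exists_smul_eq_of_isMax hM hM'
            refine Subtype.ext (mk_eq_mk_iff.2 ⟨g, Subtype.ext ?_⟩)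
            rw [eq_single hyM, eq_single]
            rw [supp_smul, hx, Finset.smul_finset_singleton] }
      infer_instance

end PSubgroupComplex

end

/-- The orbit space `|S_p(G)|/G`, with the quotient topology, is contractible. -/
theorem mainTheorem1 (G : Type*) [Group G] [Finite G] (p : ℕ) (hp : p.Prime)
    (hpG : p ∣ Nat.card G) :
    ContractibleSpace (MulAction.orbitRel.Quotient G (PSubgroupComplex p G)) := by
  classical
  have : Fact p.Prime := ⟨hp⟩
  have : Nonempty (PSubgroups p G) := PSubgroups.nonempty_of_dvd_card hpG
  let L : Finset (Finset (PSubgroups p G)) :=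
    Finset.univ.filter fun s => s.Nonempty ∧ IsChain (· ≤ ·) (s : Set (PSubgroups p G))
  have hmem : ∀ s, s ∈ L ↔ s.Nonempty ∧ IsChain (· ≤ ·) (s : Set (PSubgroups p G)) := by
    simp [L]
  have hL : PSubgroups.ApexClosed L :=
    { nonempty := fun s hs => ((hmem s).1 hs).1
      isChain := fun s hs => ((hmem s).1 hs).2
      down := fun s hs t hts ht =>
        (hmem t).2 ⟨ht, ((hmem s).1 hs).2.mono (Finset.coe_subset.2 hts)⟩
      smul := fun s hs g => by
        refine (hmem _).2 ⟨((hmem s).1 hs).1.smul_finset, ?_⟩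
        rw [Finset.coe_smul_finset]
        rintro _ ⟨P, hP, rfl⟩ _ ⟨Q, hQ, rfl⟩ -
        exact (((hmem s).1 hs).2.total hP hQ).imp (PSubgroups.smul_le_smul g)
          (PSubgroups.smul_le_smul g)
      apex := fun s hs T hT => by
        convert (hmem (insert T s)).2
          ⟨Finset.insert_nonempty _ _, by convert hT.isChain_insert ((hmem s).1 hs).2⟩
      singleton := fun M _ => (hmem _).2 ⟨Finset.singleton_nonempty M, by simp⟩ }
  have hc := PSubgroupComplex.contractibleSpace_orbitImage L hL
  have huniv : PSubgroupComplex.orbitImage L = Set.univ := by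
    refine Set.eq_univ_of_forall fun y => ?_
    induction y using Quotient.inductionOn with
    | h x =>
      exact ⟨x, (hmem _).2
        ⟨PSubgroupComplex.supp_nonempty x, PSubgroupComplex.isChain_supp x⟩, rfl⟩
  rw [huniv] at hc
  exact (Homeomorph.Set.univ _).symm.toHomotopyEquiv.contractibleSpace
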